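/- **Setting.** The $\lambda C$-terms are the $\lambda$-terms (modulo $\alpha$-equivalence) built with one additional constant $C$; $(t)u_1\dots u_k$ denotes application. Types are the formulas of second order predicate logic over a first order language containing a constant $0$ and a unary function symbol $s$, built with a propositional constant $\bot$, $\to$, $\forall x$ ($x$ an individual variable), $\forall X$ ($X$ an $n$-ary predicate variable) and $\forall X_C$, where the $X_C$ are additional $n$-ary second order variables called classical variables; $\neg A$ is $A\to\bot$. A type is *classical* if it ends with $\bot$ or with a classical variable, where $X(t_1,\dots,t_n)$ ends with $X$, and if $B$ ends with $X$ then so do $A\to B$ and $\forall v B$, for every type $A$ and every variable $v$. Let $E$ be a set of equations between first order terms and $\approx$ the least congruence on terms containing all substitution instances of $E$. Assume that $E$ is adequate with the type of integers: for all terms $a,b$, $s(a)\not\approx 0$, and $s(a)\approx s(b)$ implies $a\approx b$. The system $M2$ derives judgements $\Gamma\vdash_{M2} t:A$, where $\Gamma=x_1:A_1,\dots,x_k:A_k$, by the rules - $\Gamma\vdash x_i:A_i$; and $\Gamma\vdash C:\forall X_C\{\neg\neg X_C\to X_C\}$ ($X_C$ of arity $0$); - from $\Gamma,x:A\vdash t:B$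 infer $\Gamma\vdash\lambda x\,t:A\to B$; from $\Gamma\vdash u:A\to B$ and $\Gamma\vdash v:A$ infer $\Gamma\vdash(u)v:B$; - from $\Gamma\vdash t:A$ infer $\Gamma\vdash t:\forall v A$, where $v$ is an individual, predicate or classical variable not free in $\Gamma$; - from $\Gamma\vdash t:\forall xA$ infer $\Gamma\vdash t:A[u/x]$ for every first order term $u$; from $\Gamma\vdash t:\forall XA$ infer $\Gamma\vdash t:A[G/X]$ for every formula $G$; from $\Gamma\vdash t:\forall X_CA$ infer $\Gamma\vdash t:A[G/X_C]$ for every classical type $G$ (for an $n$-ary variable, $G$ comes with $n$ distinguished individual variables, which are replaced by the arguments of the variable); - from $\Gamma\vdash t:A[u/x]$ and $u\approx v$ infer $\Gamma\vdash t:A[v/x]$. Put $N^C[t]=\forall X_C\{X_C(0),\forall y(X_C(y)\to X_C(sy))\to X_C(t)\}$ with $X_C$ unary, where $A,B\to D$ means $A\to(B\to D)$. A *classical integer of value $n$* is a closed $\lambda C$-term $\theta_n$ with $\vdash_{M2}\theta_n:N^C[s^n(0)]$. Let $P$ be an infinite set of constants, called stack constants. Let $\Lambda CP$ be the least set that contains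 the variables and $C$, and such that if $t\in\Lambda CP$ then $\lambda x\,t\in\Lambda CP$ for every variable $x$, and $(t)u\in\Lambda CP$ for every $u\in\Lambda CP\cup P$. For $t,t'\in\Lambda CP$ write $t\triangleright_C t'$ if $t'$ is obtained from $t$ by applying the following rules finitely many (possibly zero) times, to whole terms, with $u,t\in\Lambda CP$, $k\ge 0$ and $t_1,\dots,t_k\in\Lambda CP\cup P$: 1. $(\lambda x\,u)t\,t_1\dots t_k\to(u[t/x])t_1\dots t_k$; 2. $(C)t\,t_1\dots t_k\to(t)\lambda x(x)t_1\dots t_k$, with $x$ not free in $t_1,\dots,t_k$. **Theorem 8.4.** Let $n\in\mathbf N$, let $\theta_n$ be a classical integer of value $n$, and let $x,g$ be two distinct variables. - If $n=0$, then for every stack constant $p$ we have $(\theta_n)xgp\triangleright_C(x)p$. - If $n\neq 0$, then there are an integer $m\ge 1$, a mapping $I:\{0,\dots,m\}\to\mathbf N$ and indices $r_0,\dots,r_m\in\{0,\dots,m\}$ with $I(0)=n$, $I(r_m)=0$ and $I(i+1)=I(r_i)-1$ for $0\le i\le m-1$, such that for all distinct stack constants $p_0,p_1,\dots,p_m$ there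 are terms $t_1,\dots,t_m\in\Lambda CP$ with $$(\theta_n)xgp_0\triangleright_C(g)t_1p_{r_0};\qquad (t_i)p_i\triangleright_C(g)t_{i+1}p_{r_i}\quad(1\le i\le m-1);\qquad (t_m)p_m\triangleright_C(x)p_{r_m}.$$ -/

import Mathlib

namespace MixedLogic

open FirstOrder FirstOrder.Language

/-! ### Pure terms

Terms are in de Bruijn notation, i.e. taken up to renaming of bound variables. A free occurrence of
`var i` under `k` binders denotes the free variable number `i - k`. -/

/-- The terms of the λC-calculus: λ-terms with one additional constant `C`. -/
inductive LamC : Type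
  | var : ℕ → LamC
  | C : LamC
  | lam : LamC → LamC
  | app : LamC → LamC → LamC

/-- All the free variables of the term have a number smaller than `k`. -/
def LamC.FreeBelow : LamC → ℕ → Prop
  | .var i, k => i < k
  | .C, _ => True
  | .lam t, k => t.FreeBelow (k + 1)
  | .app t u, k => t.FreeBelow k ∧ u.FreeBelow k

/-- A term without free variables. -/
def LamC.Closed (t : LamC) : Prop := t.FreeBelow 0

/-- The set `ΛCP` of λC-terms with stack constants from `P`: the stack constants occur in argument
position only. `app t u` is `(t)u` for a term `u`, and `appStack t p` is `(t)p` for a stack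
constant `p`. -/
inductive LamCP (P : Type*) : Type _
  | var : ℕ → LamCP P
  | C : LamCP P
  | lam : LamCP P → LamCP P
  | app : LamCP P → LamCP P → LamCP P
  | appStack : LamCP P → P → LamCP P

/-- A λC-term, seen as an element of `ΛCP` (without stack constants). -/
def LamC.toLamCP (P : Type*) : LamC → LamCP P
  | .var i => .var i
  | .C => .C
  | .lam t => .lam (t.toLamCP P)
  | .app t u => .app (t.toLamCP P) (u.toLamCP P)

namespace LamCP

variable {P : Type*}

/-- Renaming of the free variables. -/
def rename : LamCP P → (ℕ → ℕ) → LamCP P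
  | .var i, ξ => .var (ξ i)
  | .C, _ => .C
  | .lam t, ξ => .lam (t.rename (fun i => Nat.casesOn i 0 (fun j => ξ j + 1)))
  | .app t u, ξ => .app (t.rename ξ) (u.rename ξ)
  | .appStack t p, ξ => .appStack (t.rename ξ) p

/-- Simultaneous capture-avoiding substitution for the free variables. -/
def subst : LamCP P → (ℕ → LamCP P) → LamCP P
  | .var i, σ => σ i
  | .C, _ => .C
  | .lam t, σ =>
      .lam (t.subst (fun i => Nat.casesOn i (.var 0) (fun j => (σ j).rename Nat.succ)))
  | .app t u, σ => .app (t.subst σ) (u.subst σ)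
  | .appStack t p, σ => .appStack (t.subst σ) p

/-- `u.inst t` is `u[t/x]`, where `x` is the variable bound by the λ in `lam u`. -/
def inst (u t : LamCP P) : LamCP P :=
  u.subst (fun i => Nat.casesOn i t (fun j => .var j))

/-- `(t)a`, where the argument `a` is a term or a stack constant. -/
def appArg (t : LamCP P) : LamCP P ⊕ P → LamCP P
  | .inl u => .app t u
  | .inr p => .appStack t p

/-- `(t)a₁ … aₙ`, where each `aᵢ` is a term or a stack constant. -/
def apps (t : LamCP P) (args : List (LamCP P ⊕ P)) : LamCP P :=
  args.foldl appArg t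

/-- Renumbering of the free variables of an argument that is moved under a new λ (whose variable
then does not appear in it). -/
def shiftArg : LamCP P ⊕ P → LamCP P ⊕ P :=
  Sum.map (fun u => u.rename Nat.succ) id

/-- One step of head `C`-reduction on `ΛCP`:
`(λx u) t t₁ … tₙ → (u[t/x]) t₁ … tₙ` and `(C) t t₁ … tₙ → (t) λx (x) t₁ … tₙ`, `x` not appearing
in `t₁, …, tₙ`. -/
inductive Step : LamCP P → LamCP P → Prop
  | beta (u t : LamCP P) (args : List (LamCP P ⊕ P)) :
      Step (apps (.app (.lam u) t) args) (apps (u.inst t) args)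
  | control (t : LamCP P) (args : List (LamCP P ⊕ P)) :
      Step (apps (.app .C t) args) (.app t (.lam (apps (.var 0) (args.map shiftArg))))

/-- `t ▷_C t'`: finitely many (possibly zero) steps of head `C`-reduction lead from `t` to `t'`. -/
def Reduces : LamCP P → LamCP P → Prop := Relation.ReflTransGen Step

end LamCP

/-! ### Types -/

/-- The two kinds of second order variables: the ordinary predicate variables `X` and the classical
variables `X_C`. -/
inductive VarKind : Type
  | ordinary
  | classical
  deriving DecidableEq

/-- The formulas of second order predicate logic over `L`, with ordinary and classical second order
variables of all arities. Individual variables, and second order variables of each kind and each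
arity, are numbered separately; bound variables are de Bruijn indices: `iall` binds the individual
variable `0`, and `pall κ n` binds the second order variable `0` of kind `κ` and arity `n`. -/
inductive Formula (L : Language) : Type _
  | bot : Formula L
  | rel {n : ℕ} : L.Relations n → (Fin n → L.Term ℕ) → Formula L
  | pvar (κ : VarKind) (n : ℕ) : ℕ → (Fin n → L.Term ℕ) → Formula L
  | imp : Formula L → Formula L → Formula L
  | iall : Formula L → Formula L
  | pall (κ : VarKind) (n : ℕ) : Formula L → Formula L

namespace Formula

variable {L : Language}

/-- The negation `¬A`, i.e. `A → ⊥`. -/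
def neg (A : Formula L) : Formula L := imp A bot

/-- Simultaneous capture-avoiding substitution of terms for the individual variables. -/
def isubst : Formula L → (ℕ → L.Term ℕ) → Formula L
  | .bot, _ => .bot
  | .rel R ts, σ => .rel R (fun i => (ts i).subst σ)
  | .pvar κ n X ts, σ => .pvar κ n X (fun i => (ts i).subst σ)
  | .imp A B, σ => .imp (A.isubst σ) (B.isubst σ)
  | .iall A, σ =>
      .iall (A.isubst (fun i => Nat.casesOn i (Term.var 0) (fun j => (σ j).relabel Nat.succ)))
  | .pall κ n A, σ => .pall κ n (A.isubst σ)

/-- Renumbering of the individual variables of a formula that is moved under a new `iall` (whose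
variable then is not free in it). -/
def ishift (A : Formula L) : Formula L := A.isubst (fun i => Term.var (i + 1))

/-- `A.iinst u` is `A[u/x]`, where `x` is the individual variable bound in `iall A`. -/
def iinst (A : Formula L) (u : L.Term ℕ) : Formula L :=
  A.isubst (fun i => Nat.casesOn i u (fun j => Term.var j))

/-- Renaming of the free second order variables; `ρ κ n` acts on those of kind `κ` and arity `n`. -/
def prename : Formula L → (VarKind → ℕ → ℕ → ℕ) → Formula L
  | .bot, _ => .bot
  | .rel R ts, _ => .rel R ts
  | .pvar κ n X ts, ρ => .pvar κ n (ρ κ n X) ts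
  | .imp A B, ρ => .imp (A.prename ρ) (B.prename ρ)
  | .iall A, ρ => .iall (A.prename ρ)
  | .pall κ n A, ρ =>
      .pall κ n (A.prename (fun κ' n' X =>
        if κ' = κ ∧ n' = n then Nat.casesOn X 0 (fun Y => ρ κ' n' Y + 1) else ρ κ' n' X))

/-- Renumbering of the second order variables of a formula that is moved under a new `pall κ n`
(whose variable then is not free in it). -/
def pshift (κ : VarKind) (n : ℕ) (A : Formula L) : Formula L :=
  A.prename (fun κ' n' X => if κ' = κ ∧ n' = n then X + 1 else X)

/-- Simultaneous capture-avoiding substitution of formulas for the second order variables. The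
formula `G = σ κ n X` that replaces an `n`-ary variable `X` is read as a formula with `n`
distinguished individual variables, those with the numbers `0, …, n - 1`, while its individual
variable `n + j` is the variable `j` of the context: `X(t₀, …, tₙ₋₁)` is replaced by
`G[t₀/0, …, tₙ₋₁/(n-1)]`. -/
def psubst : Formula L → (VarKind → ℕ → ℕ → Formula L) → Formula L
  | .bot, _ => .bot
  | .rel R ts, _ => .rel R ts
  | .pvar κ n X ts, σ =>
      (σ κ n X).isubst (fun j => if h : j < n then ts ⟨j, h⟩ else Term.var (j - n))
  | .imp A B, σ => .imp (A.psubst σ) (B.psubst σ)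
  | .iall A, σ =>
      .iall (A.psubst (fun κ n X =>
        (σ κ n X).isubst (fun j => if j < n then Term.var j else Term.var (j + 1))))
  | .pall κ n A, σ =>
      .pall κ n (A.psubst (fun κ' n' X =>
        if κ' = κ ∧ n' = n then
          Nat.casesOn X (.pvar κ' n' 0 (fun j => Term.var j)) (fun Y => (σ κ' n' Y).pshift κ n)
        else (σ κ' n' X).pshift κ n))

/-- `A.pinst κ n G` is `A[G/X]`, where `X` is the second order variable bound in `pall κ n A`. The
formula `G` is read as in `psubst`. -/
def pinst (κ : VarKind) (n : ℕ) (A G : Formula L) : Formula L :=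
  A.psubst (fun κ' n' X =>
    if κ' = κ ∧ n' = n then
      Nat.casesOn X G (fun Y => .pvar κ' n' Y (fun j => Term.var j))
    else .pvar κ' n' X (fun j => Term.var j))

/-- The classical types: the formulas that end with `⊥` or with a classical variable. -/
def IsClassicalType : Formula L → Prop
  | .bot => True
  | .rel _ _ => False
  | .pvar κ _ _ _ => κ = .classical
  | .imp _ B => B.IsClassicalType
  | .iall A => A.IsClassicalType
  | .pall _ _ A => A.IsClassicalType

/-- The translation `A ↦ A^C` of the formulas `A` without classical variables: each second order
variable `X` is replaced by the classical variable `X_C`. -/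
def toClassical : Formula L → Formula L
  | .bot => .bot
  | .rel R ts => .rel R ts
  | .pvar _ n X ts => .pvar .classical n X ts
  | .imp A B => .imp A.toClassical B.toClassical
  | .iall A => .iall A.toClassical
  | .pall _ n A => .pall .classical n A.toClassical

end Formula

/-! ### Equations and integers -/

section Typing

variable {L : Language}

/-- `u ≈ v` modulo the set `E` of equations: the least congruence on the terms of `L` that contains
all the substitution instances of the equations of `E`. -/
inductive EqMod (E : Set (L.Term ℕ × L.Term ℕ)) : L.Term ℕ → L.Term ℕ → Prop
  | instance_of {a b : L.Term ℕ} (h : (a, b) ∈ E) (σ : ℕ → L.Term ℕ) :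
      EqMod E (a.subst σ) (b.subst σ)
  | refl (a : L.Term ℕ) : EqMod E a a
  | symm {a b : L.Term ℕ} : EqMod E a b → EqMod E b a
  | trans {a b c : L.Term ℕ} : EqMod E a b → EqMod E b c → EqMod E a c
  | func {n : ℕ} (f : L.Functions n) {as bs : Fin n → L.Term ℕ} :
      (∀ i, EqMod E (as i) (bs i)) → EqMod E (Term.func f as) (Term.func f bs)

/-- The term `s(t)`. -/
def succTerm (succ : L.Functions 1) (t : L.Term ℕ) : L.Term ℕ := Term.func succ ![t]

/-- The term `sⁿ(0)`. -/
def numeral (zero : L.Functions 0) (succ : L.Functions 1) : ℕ → L.Term ℕ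
  | 0 => Term.func zero ![]
  | n + 1 => succTerm succ (numeral zero succ n)

/-- The set `E` of equations is adequate with the type of integers: `s(a) ≉ 0`, and
`s(a) ≈ s(b)` implies `a ≈ b`. -/
def Adequate (zero : L.Functions 0) (succ : L.Functions 1)
    (E : Set (L.Term ℕ × L.Term ℕ)) : Prop :=
  (∀ a : L.Term ℕ, ¬ EqMod E (succTerm succ a) (Term.func zero ![])) ∧
  (∀ a b : L.Term ℕ, EqMod E (succTerm succ a) (succTerm succ b) → EqMod E a b)

/-- The type of integers `N[t] = ∀X {X(0), ∀y (X(y) → X(sy)) → X(t)}`. -/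
def natType (zero : L.Functions 0) (succ : L.Functions 1) (t : L.Term ℕ) : Formula L :=
  let X : L.Term ℕ → Formula L := fun u => .pvar .ordinary 1 0 ![u]
  .pall .ordinary 1
    (.imp (X (Term.func zero ![]))
      (.imp (.iall (.imp (X (Term.var 0)) (X (succTerm succ (Term.var 0)))))
        (X t)))

/-- The system `M2`: `M2 E Γ t A` is `Γ ⊢ t : A` with respect to the equations `E`. The variable
`i` of `t` has the type number `i` in the context `Γ`. -/
inductive M2 (E : Set (L.Term ℕ × L.Term ℕ)) : List (Formula L) → LamC → Formula L → Prop
  /-- The declaration `C : ∀X_C {¬¬X_C → X_C}`. -/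
  | control (Γ : List (Formula L)) :
      M2 E Γ .C (.pall .classical 0
        (.imp (Formula.neg (Formula.neg (.pvar .classical 0 0 ![]))) (.pvar .classical 0 0 ![])))
  | var {Γ : List (Formula L)} {i : ℕ} {A : Formula L} :
      Γ[i]? = some A → M2 E Γ (.var i) A
  | lam {Γ : List (Formula L)} {t : LamC} {A B : Formula L} :
      M2 E (A :: Γ) t B → M2 E Γ (.lam t) (.imp A B)
  | app {Γ : List (Formula L)} {u v : LamC} {A B : Formula L} :
      M2 E Γ u (.imp A B) → M2 E Γ v A → M2 E Γ (.app u v) B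
  | iall_intro {Γ : List (Formula L)} {t : LamC} {A : Formula L} :
      M2 E (Γ.map Formula.ishift) t A → M2 E Γ t (.iall A)
  | iall_elim {Γ : List (Formula L)} {t : LamC} {A : Formula L} (u : L.Term ℕ) :
      M2 E Γ t (.iall A) → M2 E Γ t (A.iinst u)
  | pall_intro {Γ : List (Formula L)} {t : LamC} {A : Formula L} {n : ℕ} :
      M2 E (Γ.map (Formula.pshift .ordinary n)) t A → M2 E Γ t (.pall .ordinary n A)
  | pall_elim {Γ : List (Formula L)} {t : LamC} {A : Formula L} {n : ℕ} (G : Formula L) :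
      M2 E Γ t (.pall .ordinary n A) → M2 E Γ t (A.pinst .ordinary n G)
  | equation {Γ : List (Formula L)} {t : LamC} {A : Formula L} {u v : L.Term ℕ} :
      M2 E Γ t (A.iinst u) → EqMod E u v → M2 E Γ t (A.iinst v)
  | call_intro {Γ : List (Formula L)} {t : LamC} {A : Formula L} {n : ℕ} :
      M2 E (Γ.map (Formula.pshift .classical n)) t A → M2 E Γ t (.pall .classical n A)
  | call_elim {Γ : List (Formula L)} {t : LamC} {A : Formula L} {n : ℕ} (G : Formula L) :
      G.IsClassicalType → M2 E Γ t (.pall .classical n A) → M2 E Γ t (A.pinst .classical n G)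

/-- `θ` is a classical integer of value `n`: a closed λC-term of type `N^C[sⁿ(0)]` in `M2`. -/
def IsClassicalInteger (zero : L.Functions 0) (succ : L.Functions 1)
    (E : Set (L.Term ℕ × L.Term ℕ)) (n : ℕ) (θ : LamC) : Prop :=
  θ.Closed ∧ M2 E [] θ (natType zero succ (numeral zero succ n)).toClassical

end Typing

end MixedLogic

open MixedLogic

/-!
The proof is a classical realizability argument in the style of Krivine. A formula `A` is
interpreted by a set of stacks (its *falsity value*), and a term realizes `A` if, applied to any
stack of that set, it falls into a fixed set of terms, the *pole*, closed under anti-reduction. The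
falsity value of `⊥` contains the empty stack only, which is exactly what makes the reduction rule
of `C` realize `¬¬X → X`, whatever set of stacks interprets `X`; so ordinary and classical variables
may both range over all sets of stacks. Individuals range over a model of the equations, and every
typable term realizes its type (`realizes_of_M2`).

The model is then the term model modulo `≈`, and the stack constants are pairs `(i, k)` of an index
and a value. The pole `Wins` is the least set of terms, closed under anti-reduction, that contains
`(x)(i, 0)` for all `i`, and `(g)t(i, k + 1)` as soon as it contains `(t)(j, k)` for all `j`. When
`X(a)` is interpreted by the stack constants whose value `k` satisfies `a ≈ sᵏ(0)`, adequacy of the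
equations says that `x` realizes `X(0)` and `g` realizes `∀y (X(y) → X(sy))`, so that
`(θₙ)xg(0, n)` is in the pole.

Membership in the pole unfolds to a run, in which the constant supplied at stage `i` is given the
index `i` (`Wins.exists_run`). Reduction creates no stack constants, so every constant
that comes back to the head has been supplied at an earlier stage, and its index and value give `r`
and `I`. Finally, reduction commutes with any renaming of the stack constants
(`Reduces.mapConst`), which sends `(i, k)` to `pᵢ`.
-/

namespace MixedLogic

open FirstOrder FirstOrder.Language

namespace LamCP

variable {P Q : Type*}

/-! ### Substitution calculus -/

theorem rename_rename (t : LamCP P) (ξ ζ : ℕ → ℕ) :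
    (t.rename ξ).rename ζ = t.rename (fun i => ζ (ξ i)) := by
  induction t generalizing ξ ζ with
  | var i => rfl
  | C => rfl
  | lam t ih =>
    simp only [rename, ih]
    congr 2; funext i; cases i <;> rfl
  | app t u iht ihu => simp only [rename, iht, ihu]
  | appStack t p ih => simp only [rename, ih]

theorem subst_rename (t : LamCP P) (ξ : ℕ → ℕ) (σ : ℕ → LamCP P) :
    (t.rename ξ).subst σ = t.subst (fun i => σ (ξ i)) := by
  induction t generalizing ξ σ with
  | var i => rfl
  | C => rfl
  | lam t ih =>
    simp only [rename, subst, ih]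
    congr 2; funext i; cases i <;> rfl
  | app t u iht ihu => simp only [rename, subst, iht, ihu]
  | appStack t p ih => simp only [rename, subst, ih]

theorem rename_subst (t : LamCP P) (σ : ℕ → LamCP P) (ξ : ℕ → ℕ) :
    (t.subst σ).rename ξ = t.subst (fun i => (σ i).rename ξ) := by
  induction t generalizing ξ σ with
  | var i => rfl
  | C => rfl
  | lam t ih =>
    simp only [rename, subst, ih]
    congr 2; funext i
    cases i with
    | zero => rfl
    | succ i => simp only [rename_rename]
  | app t u iht ihu => simp only [rename, subst, iht, ihu]
  | appStack t p ih => simp only [rename, subst, ih]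

theorem subst_subst (t : LamCP P) (σ τ : ℕ → LamCP P) :
    (t.subst σ).subst τ = t.subst (fun i => (σ i).subst τ) := by
  induction t generalizing σ τ with
  | var i => rfl
  | C => rfl
  | lam t ih =>
    simp only [subst, ih]
    congr 2; funext i
    cases i with
    | zero => rfl
    | succ i => simp only [subst_rename, rename_subst]
  | app t u iht ihu => simp only [subst, iht, ihu]
  | appStack t p ih => simp only [subst, ih]

theorem subst_var (t : LamCP P) : t.subst .var = t := by
  induction t with
  | var i => rfl
  | C => rfl
  | lam t ih =>
    simp only [subst]
    congr 1
    convert ih using 2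
    funext i; cases i <;> rfl
  | app t u iht ihu => simp only [subst, iht, ihu]
  | appStack t p ih => simp only [subst, ih]

theorem inst_rename_succ (t u : LamCP P) : (t.rename Nat.succ).inst u = t := by
  rw [inst, subst_rename]
  exact subst_var t

theorem inst_subst_lift (t u : LamCP P) (σ : ℕ → LamCP P) :
    (t.subst (fun i => Nat.casesOn i (.var 0) (fun j => (σ j).rename Nat.succ))).inst u =
      t.subst (fun i => Nat.casesOn i u σ) := by
  rw [inst, subst_subst]
  congr 1; funext i
  cases i with
  | zero => rfl
  | succ i => exact inst_rename_succ (σ i) u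

theorem inst_apps_shiftArg (t u : LamCP P) (args : List (LamCP P ⊕ P)) :
    (apps t (args.map shiftArg)).inst u = apps (t.inst u) args := by
  induction args generalizing t with
  | nil => rfl
  | cons a args ih =>
    refine (ih (appArg t (shiftArg a))).trans (congrArg (apps · args) ?_)
    rcases a with a | p
    · exact congrArg (LamCP.app (t.inst u)) (inst_rename_succ a u)
    · rfl

/-! ### Renaming of the stack constants -/

/-- Replacement of each stack constant `p` by `f p`. -/
def mapConst (f : P → Q) : LamCP P → LamCP Q
  | .var i => .var i
  | .C => .C
  | .lam t => .lam (t.mapConst f)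
  | .app t u => .app (t.mapConst f) (u.mapConst f)
  | .appStack t p => .appStack (t.mapConst f) (f p)

theorem mapConst_toLamCP (f : P → Q) (t : LamC) :
    (t.toLamCP P).mapConst f = t.toLamCP Q := by
  induction t <;> simp_all [LamC.toLamCP, mapConst]

theorem mapConst_rename (f : P → Q) (t : LamCP P) (ξ : ℕ → ℕ) :
    (t.rename ξ).mapConst f = (t.mapConst f).rename ξ := by
  induction t generalizing ξ <;> simp_all [rename, mapConst]

theorem mapConst_subst (f : P → Q) (t : LamCP P) (σ : ℕ → LamCP P) :
    (t.subst σ).mapConst f = (t.mapConst f).subst (fun i => (σ i).mapConst f) := by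
  induction t generalizing σ with
  | var i => rfl
  | C => rfl
  | lam t ih =>
    simp only [subst, mapConst, ih]
    congr 2; funext i
    cases i with
    | zero => rfl
    | succ i => exact mapConst_rename f _ _
  | app t u iht ihu => simp only [subst, mapConst, iht, ihu]
  | appStack t p ih => simp only [subst, mapConst, ih]

theorem mapConst_inst (f : P → Q) (t u : LamCP P) :
    (t.inst u).mapConst f = (t.mapConst f).inst (u.mapConst f) := by
  rw [inst, mapConst_subst, inst]
  congr 1; funext i; cases i <;> rfl

theorem mapConst_apps (f : P → Q) (t : LamCP P) (args : List (LamCP P ⊕ P)) :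
    (apps t args).mapConst f = apps (t.mapConst f) (args.map (Sum.map (mapConst f) f)) := by
  induction args generalizing t with
  | nil => rfl
  | cons a args ih =>
    refine (ih (appArg t a)).trans ?_
    rcases a with a | p <;> rfl

theorem Step.mapConst (f : P → Q) {t u : LamCP P} (h : Step t u) :
    Step (t.mapConst f) (u.mapConst f) := by
  cases h with
  | beta u t args =>
    rw [mapConst_apps, mapConst_apps, mapConst_inst]
    exact Step.beta _ _ _
  | control t args =>
    have hshift : (args.map shiftArg).map (Sum.map (LamCP.mapConst f) f) =
        (args.map (Sum.map (LamCP.mapConst f) f)).map shiftArg := by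
      rw [List.map_map, List.map_map]
      congr 1; funext a
      rcases a with a | p
      · exact congrArg Sum.inl (mapConst_rename f a _)
      · rfl
    simp only [LamCP.mapConst, mapConst_apps, hshift]
    exact Step.control _ _

theorem Reduces.mapConst (f : P → Q) {t u : LamCP P} (h : t.Reduces u) :
    (t.mapConst f).Reduces (u.mapConst f) :=
  Relation.ReflTransGen.lift (p := Step) (LamCP.mapConst f) (fun _ _ => Step.mapConst f) _ _ h

/-! ### Stack constants that occur in a term -/

/-- All the stack constants of the term are in `S`. -/
def ConstsIn (S : Set P) : LamCP P → Prop
  | .var _ => True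
  | .C => True
  | .lam t => t.ConstsIn S
  | .app t u => t.ConstsIn S ∧ u.ConstsIn S
  | .appStack t p => t.ConstsIn S ∧ p ∈ S

theorem constsIn_toLamCP (S : Set P) (t : LamC) : (t.toLamCP P).ConstsIn S := by
  induction t <;> simp_all [LamC.toLamCP, ConstsIn]

theorem ConstsIn.mono {S T : Set P} (hST : S ⊆ T) {t : LamCP P} (h : t.ConstsIn S) :
    t.ConstsIn T := by
  induction t with
  | var i => trivial
  | C => trivial
  | lam t ih => exact ih h
  | app t u iht ihu => exact ⟨iht h.1, ihu h.2⟩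
  | appStack t p ih => exact ⟨ih h.1, hST h.2⟩

theorem constsIn_rename {S : Set P} {t : LamCP P} {ξ : ℕ → ℕ} :
    (t.rename ξ).ConstsIn S ↔ t.ConstsIn S := by
  induction t generalizing ξ <;> simp_all [rename, ConstsIn]

theorem ConstsIn.subst {S : Set P} {t : LamCP P} {σ : ℕ → LamCP P} (ht : t.ConstsIn S)
    (hσ : ∀ i, (σ i).ConstsIn S) : (t.subst σ).ConstsIn S := by
  induction t generalizing σ with
  | var i => exact hσ i
  | C => trivial
  | lam t ih =>
    refine ih ht fun i => ?_
    cases i with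
    | zero => trivial
    | succ i => exact constsIn_rename.2 (hσ i)
  | app t u iht ihu => exact ⟨iht ht.1 hσ, ihu ht.2 hσ⟩
  | appStack t p ih => exact ⟨ih ht.1 hσ, ht.2⟩

theorem ConstsIn.inst {S : Set P} {t u : LamCP P} (ht : t.ConstsIn S) (hu : u.ConstsIn S) :
    (t.inst u).ConstsIn S :=
  ht.subst fun i => by
    cases i with
    | zero => exact hu
    | succ i => trivial

theorem constsIn_apps {S : Set P} {t : LamCP P} {args : List (LamCP P ⊕ P)} :
    (apps t args).ConstsIn S ↔
      t.ConstsIn S ∧ ∀ a ∈ args, Sum.elim (ConstsIn S) (· ∈ S) a := by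
  induction args generalizing t with
  | nil => simp [apps]
  | cons a args ih =>
    refine (ih (t := appArg t a)).trans ?_
    rcases a with a | p <;> simp [appArg, ConstsIn, and_assoc]

theorem Step.constsIn {S : Set P} {t u : LamCP P} (h : Step t u) (ht : t.ConstsIn S) :
    u.ConstsIn S := by
  cases h with
  | beta u t args =>
    obtain ⟨⟨hu, ht⟩, hargs⟩ := constsIn_apps.1 ht
    exact constsIn_apps.2 ⟨ConstsIn.inst hu ht, hargs⟩
  | control t args =>
    obtain ⟨⟨-, ht⟩, hargs⟩ := constsIn_apps.1 ht
    refine ⟨ht, constsIn_apps.2 ⟨trivial, fun a ha => ?_⟩⟩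
    obtain ⟨b, hb, rfl⟩ := List.mem_map.1 ha
    have := hargs b hb
    rcases b with b | p
    · exact constsIn_rename.2 this
    · exact this

end LamCP

/-! ### Falsity values -/

section Semantics

variable {L : Language} {M : Type*} [L.Structure M] {P : Type*}

/-- The stacks, i.e. the finite sequences of arguments. -/
abbrev Stack (P : Type*) : Type _ := List (LamCP P ⊕ P)

/-- The terms that fall into the pole `pole` when they are applied to any stack of `F`. -/
def Realizers (pole : Set (LamCP P)) (F : Set (Stack P)) : Set (LamCP P) :=
  {t | ∀ π ∈ F, LamCP.apps t π ∈ pole}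

/-- The interpretations of the second order variables, of both kinds and all arities: an `n`-ary
variable is interpreted by an `n`-ary function from the individuals to the sets of stacks. -/
abbrev PredVal (M P : Type*) : Type _ :=
  VarKind → (n : ℕ) → ℕ → (Fin n → M) → Set (Stack P)

/-- The interpretation `ρ`, shifted at kind `κ` and arity `n` to make place for the value `F` of the
second order variable `0`. -/
def PredVal.cons {κ : VarKind} {n : ℕ} (F : (Fin n → M) → Set (Stack P)) (ρ : PredVal M P) :
    PredVal M P := fun κ' n' X as =>
  if h : κ' = κ ∧ n' = n then
    Nat.casesOn X (F (fun i => as (Fin.cast h.2.symm i))) (fun Y => ρ κ' n' Y as)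
  else ρ κ' n' X as

/-- The individuals `as` followed by those of the valuation `e`, which interpret a formula with
`n` distinguished individual variables. -/
def appendVal {n : ℕ} (as : Fin n → M) (e : ℕ → M) : ℕ → M :=
  fun j => if h : j < n then as ⟨j, h⟩ else e (j - n)

/-- The falsity value of a formula. No rule of the type system concerns the relation symbols of the
language, which get the empty falsity value. -/
def Formula.falsity (pole : Set (LamCP P)) :
    Formula L → (ℕ → M) → PredVal M P → Set (Stack P)
  | .bot, _, _ => {[]}
  | .rel _ _, _, _ => ∅
  | .pvar κ n X ts, e, ρ => ρ κ n X (fun i => (ts i).realize e)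
  | .imp A B, e, ρ =>
      {π | ∃ u ∈ Realizers pole (A.falsity pole e ρ), ∃ π' ∈ B.falsity pole e ρ,
        π = .inl u :: π'}
  | .iall A, e, ρ => ⋃ a : M, A.falsity pole (fun i => Nat.casesOn i a e) ρ
  | .pall κ n A, e, ρ =>
      ⋃ F : (Fin n → M) → Set (Stack P), A.falsity pole e (PredVal.cons (κ := κ) F ρ)

theorem Formula.falsity_isubst (pole : Set (LamCP P)) (A : Formula L) (σ : ℕ → L.Term ℕ)
    (e : ℕ → M) (ρ : PredVal M P) :
    (A.isubst σ).falsity pole e ρ = A.falsity pole (fun i => (σ i).realize e) ρ := by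
  induction A generalizing σ e ρ with
  | bot => rfl
  | rel R ts => rfl
  | pvar κ n X ts => simp only [isubst, falsity, Term.realize_subst]
  | imp A B ihA ihB => simp only [isubst, falsity, ihA, ihB]
  | iall A ih =>
    simp only [isubst, falsity, ih]
    congr 1; funext a; congr 1; funext i
    cases i with
    | zero => rfl
    | succ i => simp only [Term.realize_relabel]; rfl
  | pall κ n A ih => simp only [isubst, falsity, ih]

theorem Formula.falsity_ishift (pole : Set (LamCP P)) (A : Formula L) (a : M) (e : ℕ → M)
    (ρ : PredVal M P) :
    A.ishift.falsity pole (fun i => Nat.casesOn i a e) ρ = A.falsity pole e ρ := by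
  rw [ishift, falsity_isubst]
  rfl

theorem Formula.falsity_iinst (pole : Set (LamCP P)) (A : Formula L) (u : L.Term ℕ)
    (e : ℕ → M) (ρ : PredVal M P) :
    (A.iinst u).falsity pole e ρ =
      A.falsity pole (fun i => Nat.casesOn i (u.realize e) e) ρ := by
  rw [iinst, falsity_isubst]
  congr 1; funext i; cases i <;> rfl

theorem Formula.falsity_prename (pole : Set (LamCP P)) (A : Formula L)
    (ξ : VarKind → ℕ → ℕ → ℕ) (e : ℕ → M) (ρ : PredVal M P) :
    (A.prename ξ).falsity pole e ρ = A.falsity pole e (fun κ n X => ρ κ n (ξ κ n X)) := by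
  induction A generalizing ξ e ρ with
  | bot => rfl
  | rel R ts => rfl
  | pvar κ n X ts => rfl
  | imp A B ihA ihB => simp only [prename, falsity, ihA, ihB]
  | iall A ih => simp only [prename, falsity, ih]
  | pall κ n A ih =>
    simp only [prename, falsity, ih]
    congr 1; funext F; congr 1; funext κ' n' X as
    by_cases h : κ' = κ ∧ n' = n
    · cases X <;> simp [PredVal.cons, h]
    · simp [PredVal.cons, h]

theorem Formula.falsity_pshift (pole : Set (LamCP P)) (A : Formula L) {κ : VarKind} {n : ℕ}
    (F : (Fin n → M) → Set (Stack P)) (e : ℕ → M) (ρ : PredVal M P) :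
    (A.pshift κ n).falsity pole e (PredVal.cons (κ := κ) F ρ) = A.falsity pole e ρ := by
  rw [pshift, falsity_prename]
  congr 1; funext κ' n' X as
  by_cases h : κ' = κ ∧ n' = n <;> simp [PredVal.cons, h]

theorem Formula.falsity_psubst (pole : Set (LamCP P)) (A : Formula L)
    (σ : VarKind → ℕ → ℕ → Formula L) (e : ℕ → M) (ρ : PredVal M P) :
    (A.psubst σ).falsity pole e ρ =
      A.falsity pole e (fun κ n X as => (σ κ n X).falsity pole (appendVal as e) ρ) := by
  induction A generalizing σ e ρ with
  | bot => rfl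
  | rel R ts => rfl
  | pvar κ n X ts =>
    simp only [psubst, falsity, falsity_isubst]
    congr 1; funext j
    by_cases h : j < n <;> simp [appendVal, h]
  | imp A B ihA ihB => simp only [psubst, falsity, ihA, ihB]
  | iall A ih =>
    simp only [psubst, falsity, ih, falsity_isubst]
    congr 1; funext a; congr 1; funext κ n X as; congr 1; funext j
    by_cases h : j < n
    · simp [appendVal, h]
    · simp [appendVal, h, show ¬ j + 1 < n by omega, show j + 1 - n = (j - n) + 1 by omega]
  | pall κ n A ih =>
    simp only [psubst, falsity, ih]
    congr 1; funext F; congr 1; funext κ' n' X as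
    by_cases h : κ' = κ ∧ n' = n
    · obtain ⟨rfl, rfl⟩ := h
      cases X with
      | zero => simp [PredVal.cons, falsity, appendVal]
      | succ X => simp [PredVal.cons, falsity_pshift]
    · simp [PredVal.cons, h, falsity_pshift]

theorem Formula.falsity_pinst (pole : Set (LamCP P)) (κ : VarKind) (n : ℕ) (A G : Formula L)
    (e : ℕ → M) (ρ : PredVal M P) :
    (pinst κ n A G).falsity pole e ρ =
      A.falsity pole e
        (PredVal.cons (κ := κ) (fun as : Fin n → M => G.falsity pole (appendVal as e) ρ) ρ) := by
  rw [pinst, falsity_psubst]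
  congr 1; funext κ' n' X as
  by_cases h : κ' = κ ∧ n' = n
  · obtain ⟨rfl, rfl⟩ := h
    cases X <;> simp [PredVal.cons, falsity, appendVal]
  · simp [PredVal.cons, h, falsity, appendVal]

/-! ### Every typable term realizes its type -/

theorem EqMod.realize_eq {E : Set (L.Term ℕ × L.Term ℕ)}
    (hM : ∀ a b, (a, b) ∈ E → ∀ e : ℕ → M, a.realize e = b.realize e)
    {u v : L.Term ℕ} (h : EqMod E u v) (e : ℕ → M) : u.realize e = v.realize e := by
  induction h with
  | instance_of h σ => simpa only [Term.realize_subst] using hM _ _ h _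
  | refl a => rfl
  | symm _ ih => exact ih.symm
  | trans _ _ ih₁ ih₂ => exact ih₁.trans ih₂
  | func f _ ih => simp only [Term.realize, ih]

/-- Adequacy of the realizability interpretation: in a model of the equations, for a pole closed
under anti-reduction, a typable term becomes a realizer of its type when its variables are replaced
by realizers of theirs. -/
theorem realizes_of_M2 {E : Set (L.Term ℕ × L.Term ℕ)}
    (hM : ∀ a b, (a, b) ∈ E → ∀ e : ℕ → M, a.realize e = b.realize e)
    {pole : Set (LamCP P)} (hpole : ∀ t u, LamCP.Step t u → u ∈ pole → t ∈ pole)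
    {Γ : List (Formula L)} {t : LamC} {A : Formula L} (h : M2 E Γ t A)
    (e : ℕ → M) (ρ : PredVal M P) (σ : ℕ → LamCP P)
    (hσ : ∀ i B, Γ[i]? = some B → σ i ∈ Realizers pole (B.falsity pole e ρ)) :
    (t.toLamCP P).subst σ ∈ Realizers pole (A.falsity pole e ρ) := by
  induction h generalizing e ρ σ with
  | control Γ =>
    intro π hπ
    simp only [Formula.falsity, Formula.neg, Set.mem_iUnion] at hπ
    obtain ⟨F, t, ht, π, hπ, rfl⟩ := hπ
    refine hpole _ _ (LamCP.Step.control t π) (ht [.inl _] ⟨_, ?_, [], rfl, rfl⟩)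
    -- The continuation `λx (x)π` realizes `¬X`.
    rintro _ ⟨u, hu, _, rfl, rfl⟩
    refine hpole _ _ (LamCP.Step.beta _ u []) ?_
    rw [LamCP.inst_apps_shiftArg]
    exact hu π hπ
  | var hi => exact hσ _ _ hi
  | lam _ ih =>
    rintro _ ⟨u, hu, π, hπ, rfl⟩
    refine hpole _ _ (LamCP.Step.beta _ u π) ?_
    rw [LamCP.inst_subst_lift]
    refine ih e ρ _ (fun i B hi => ?_) π hπ
    cases i with
    | zero => cases hi; exact hu
    | succ i => exact hσ i B hi
  | app _ _ ihu ihv =>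
    intro π hπ
    exact ihu e ρ σ hσ _ ⟨_, ihv e ρ σ hσ, π, hπ, rfl⟩
  | iall_intro _ ih =>
    intro π hπ
    obtain ⟨a, ha⟩ := Set.mem_iUnion.1 hπ
    refine ih _ ρ σ (fun i B hi => ?_) π ha
    obtain ⟨B, hB, rfl⟩ := Option.map_eq_some_iff.1 (List.getElem?_map .. ▸ hi)
    rw [Formula.falsity_ishift]
    exact hσ i B hB
  | iall_elim u _ ih =>
    intro π hπ
    rw [Formula.falsity_iinst] at hπ
    exact ih e ρ σ hσ π (Set.mem_iUnion.2 ⟨_, hπ⟩)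
  | pall_intro _ ih | call_intro _ ih =>
    intro π hπ
    obtain ⟨F, hF⟩ := Set.mem_iUnion.1 hπ
    refine ih e _ σ (fun i B hi => ?_) π hF
    obtain ⟨B, hB, rfl⟩ := Option.map_eq_some_iff.1 (List.getElem?_map .. ▸ hi)
    rw [Formula.falsity_pshift]
    exact hσ i B hB
  | pall_elim G _ ih | call_elim G _ _ ih =>
    intro π hπ
    rw [Formula.falsity_pinst] at hπ
    exact ih e ρ σ hσ π (Set.mem_iUnion.2 ⟨_, hπ⟩)
  | equation _ huv ih =>
    have := ih e ρ σ hσ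
    rwa [Formula.falsity_iinst, huv.realize_eq hM, ← Formula.falsity_iinst] at this

end Semantics

/-! ### The term model of the equations -/

section TermModel

variable {L : Language} (E : Set (L.Term ℕ × L.Term ℕ))

/-- Equality of terms modulo the equations of `E`, as an equivalence relation. -/
def eqModSetoid : Setoid (L.Term ℕ) := ⟨EqMod E, .refl, .symm, .trans⟩

/-- The terms modulo the equations of `E`. -/
def TermModel : Type _ := Quotient (eqModSetoid E)

/-- The function symbols act on classes of terms; the relation symbols, which play no role, are
interpreted by the empty relation. -/
noncomputable instance : L.Structure (TermModel E) where
  funMap f as := Quotient.mk (eqModSetoid E) (Term.func f fun i => (as i).out)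
  RelMap _ _ := False

theorem termModel_funMap_mk {n : ℕ} (f : L.Functions n) (ts : Fin n → L.Term ℕ) :
    Structure.funMap (M := TermModel E) f (fun i => Quotient.mk (eqModSetoid E) (ts i)) =
      Quotient.mk (eqModSetoid E) (Term.func f ts) :=
  Quotient.sound (EqMod.func f fun i => Quotient.mk_out (s := eqModSetoid E) (ts i))

theorem termModel_realize (t : L.Term ℕ) (σ : ℕ → L.Term ℕ) :
    t.realize (M := TermModel E) (fun i => Quotient.mk (eqModSetoid E) (σ i)) =
      Quotient.mk (eqModSetoid E) (t.subst σ) := by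
  induction t with
  | var i => rfl
  | func f ts ih =>
    simp only [Term.realize, Term.subst, ih]
    exact termModel_funMap_mk E f _

theorem termModel_realize_eq {a b : L.Term ℕ} (h : (a, b) ∈ E) (e : ℕ → TermModel E) :
    a.realize e = b.realize e := by
  obtain ⟨σ, rfl⟩ : ∃ σ : ℕ → L.Term ℕ, e = fun i => Quotient.mk (eqModSetoid E) (σ i) :=
    ⟨fun i => (e i).out, funext fun i => (Quotient.out_eq (e i)).symm⟩
  rw [termModel_realize, termModel_realize]
  exact Quotient.sound (EqMod.instance_of h σ)

variable {E}

theorem eqMod_of_mk_eq {a b : L.Term ℕ}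
    (h : Quotient.mk (eqModSetoid E) a = Quotient.mk (eqModSetoid E) b) : EqMod E a b :=
  Quotient.exact h

end TermModel

/-! ### The pole -/

/-- The pole for the head variables `x` and `g`: the constant `(i, k)` has index `i` and value `k`.
The variable `x` may be given a constant of value `0`; the variable `g` may be given `t` and a
constant of value `k + 1` if `t` may be given all the constants of value `k`. -/
inductive Wins (x g : ℕ) : LamCP (ℕ × ℕ) → Prop
  | zero (i : ℕ) : Wins x g (.appStack (.var x) (i, 0))
  | succ (t : LamCP (ℕ × ℕ)) (i k : ℕ) (h : ∀ j, Wins x g (.appStack t (j, k))) :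
      Wins x g (.appStack (.app (.var g) t) (i, k + 1))
  | step (t u : LamCP (ℕ × ℕ)) (h : LamCP.Step t u) (hu : Wins x g u) : Wins x g t

theorem wins_of_isClassicalInteger {L : Language} {zero : L.Functions 0} {succ : L.Functions 1}
    {E : Set (L.Term ℕ × L.Term ℕ)} (hE : Adequate zero succ E) {n : ℕ} {θ : LamC}
    (hθ : IsClassicalInteger zero succ E n θ) (x g i : ℕ) :
    Wins x g (.appStack (.app (.app (θ.toLamCP (ℕ × ℕ)) (.var x)) (.var g)) (i, n)) := by
  let F : (Fin 1 → TermModel E) → Set (Stack (ℕ × ℕ)) := fun as =>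
    {π | ∃ i k, as 0 = Quotient.mk (eqModSetoid E) (numeral zero succ k) ∧ π = [.inr (i, k)]}
  let e : ℕ → TermModel E := fun i => Quotient.mk (eqModSetoid E) (.var i)
  have he (t : L.Term ℕ) : t.realize e = Quotient.mk (eqModSetoid E) t := by
    refine (termModel_realize E t _).trans (congrArg _ ?_)
    induction t with
    | var i => rfl
    | func f ts ih => simp only [Term.subst, ih]
  have h := realizes_of_M2 (M := TermModel E) (pole := {t | Wins x g t})
    (fun _ _ => termModel_realize_eq E) Wins.step hθ.2 e (fun _ _ _ _ => ∅) .var (by simp)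
  rw [LamCP.subst_var] at h
  refine h [.inl (.var x), .inl (.var g), .inr (i, n)] (Set.mem_iUnion.2 ⟨F, ?_⟩)
  refine ⟨_, ?_, _, ⟨_, ?_, [.inr (i, n)], ⟨i, n, he _, rfl⟩, rfl⟩, rfl⟩
  · rintro _ ⟨i, k, hk, rfl⟩
    cases k with
    | zero => exact Wins.zero i
    | succ k => exact (hE.1 _ (eqMod_of_mk_eq ((he _).symm.trans hk)).symm).elim
  · rintro _ hπ
    obtain ⟨a, u, hu, _, ⟨i, k, hk, rfl⟩, rfl⟩ := Set.mem_iUnion.1 hπ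
    obtain ⟨b, rfl⟩ := Quotient.exists_rep a
    have hb : (succTerm succ (Term.var 0)).realize
        (fun i => Nat.casesOn i (Quotient.mk (eqModSetoid E) b) e : ℕ → TermModel E) =
        Quotient.mk (eqModSetoid E) (succTerm succ b) := by
      refine Eq.trans ?_ (termModel_funMap_mk E succ ![b])
      simp only [succTerm, Term.realize]
      congr 1; funext i
      fin_cases i; rfl
    have hk' := eqMod_of_mk_eq (hb.symm.trans hk)
    cases k with
    | zero => exact (hE.1 _ hk').elim
    | succ k =>
      refine Wins.succ u i k fun j => hu [.inr (j, k)] ⟨j, k, ?_, rfl⟩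
      exact Quotient.sound (hE.2 _ _ hk')

/-! ### Runs -/

/-- A term of the pole, whose constants are those supplied at the stages `0, …, i`, starts a run. At
stage `j` the run is in the term `q j`, and it calls back the constant supplied at the stage
`r j ≤ j`; the one supplied at stage `j` is `(j, I j)`. -/
theorem Wins.exists_run {x g : ℕ} {u : LamCP (ℕ × ℕ)} (h : Wins x g u) (i : ℕ) (J : ℕ → ℕ)
    (hu : u.ConstsIn {p | p.1 ≤ i ∧ J p.1 = p.2}) :
    ∃ (m : ℕ) (I r : ℕ → ℕ) (t q : ℕ → LamCP (ℕ × ℕ)),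
      i ≤ m ∧ (∀ j ≤ i, I j = J j) ∧ (∀ j, i ≤ j → j ≤ m → r j ≤ j) ∧
      I (r m) = 0 ∧ (∀ j, i ≤ j → j < m → I (r j) = I (j + 1) + 1) ∧
      q i = u ∧ (∀ j, i < j → j ≤ m → q j = .appStack (t j) (j, I j)) ∧
      (∀ j, i ≤ j → j < m →
        (q j).Reduces (.appStack (.app (.var g) (t (j + 1))) (r j, I (r j)))) ∧
      (q m).Reduces (.appStack (.var x) (r m, I (r m))) := by
  induction h generalizing i J with
  | zero k =>
    obtain ⟨-, hk, hJ⟩ := hu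
    refine ⟨i, J, fun j => k, fun _ => .C, fun _ => _, le_rfl, fun _ _ => rfl,
      fun j hj _ => hk.trans hj, hJ, fun j h₁ h₂ => absurd h₂ (by omega), rfl,
      fun j h₁ h₂ => absurd h₂ (by omega), fun j h₁ h₂ => absurd h₂ (by omega), ?_⟩
    rw [show J k = 0 from hJ]
    exact .refl
  | succ s a k _ ih =>
    obtain ⟨⟨-, hs⟩, ha, hJ⟩ := hu
    have hsub : {p : ℕ × ℕ | p.1 ≤ i ∧ J p.1 = p.2} ⊆
        {p | p.1 ≤ i + 1 ∧ Function.update J (i + 1) k p.1 = p.2} := by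
      rintro ⟨b, c⟩ ⟨hb, hc⟩
      refine ⟨Nat.le_succ_of_le hb, ?_⟩
      rwa [Function.update_of_ne (Nat.lt_succ_of_le hb).ne]
    -- The fresh constant of value `k` gets the index of the next stage.
    obtain ⟨m, I, r, t, q, him, hI, hr, hrm, hIr, hq, hqt, hred, hend⟩ :=
      ih (i + 1) (i + 1) (Function.update J (i + 1) k)
        ⟨hs.mono hsub, le_rfl, Function.update_self ..⟩
    have hI₁ : I (i + 1) = k := by rw [hI _ le_rfl, Function.update_self]
    have hI₀ : ∀ j ≤ i, I j = J j := fun j hj => by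
      rw [hI j (by omega), Function.update_of_ne (by omega)]
    have hIa : I a = k + 1 := (hI₀ a ha).trans hJ
    refine ⟨m, I, Function.update r i a, Function.update t (i + 1) s,
      Function.update q i (.appStack (.app (.var g) s) (a, k + 1)), by omega, hI₀,
      fun j h₁ h₂ => ?_, ?_, fun j h₁ h₂ => ?_, Function.update_self .., fun j h₁ h₂ => ?_,
      fun j h₁ h₂ => ?_, ?_⟩
    · rcases eq_or_ne j i with rfl | hj
      · rwa [Function.update_self]
      · rw [Function.update_of_ne hj]; exact hr j (by omega) h₂
    · rwa [Function.update_of_ne (by omega)]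
    · rcases eq_or_ne j i with rfl | hj
      · rw [Function.update_self, hIa, hI₁]
      · rw [Function.update_of_ne hj]; exact hIr j (by omega) h₂
    · rw [Function.update_of_ne (by omega)]
      rcases eq_or_ne j (i + 1) with rfl | hj
      · rw [Function.update_self, hq, hI₁]
      · rw [Function.update_of_ne hj]; exact hqt j (by omega) h₂
    · rcases eq_or_ne j i with rfl | hj
      · rw [Function.update_self, Function.update_self, Function.update_self, hIa]
        exact .refl
      · rw [Function.update_of_ne hj, Function.update_of_ne hj, Function.update_of_ne (by omega)]
        exact hred j (by omega) h₂
    · rw [Function.update_of_ne (by omega), Function.update_of_ne (by omega)]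
      exact hend
  | step u v huv _ ih =>
    obtain ⟨m, I, r, t, q, him, hI, hr, hrm, hIr, hq, hqt, hred, hend⟩ :=
      ih i J (huv.constsIn hu)
    have hq' {w} (j : ℕ) (hw : (q j).Reduces w) : (Function.update q i u j).Reduces w := by
      rcases eq_or_ne j i with rfl | hj
      · rw [Function.update_self]
        exact .head huv (hq ▸ hw)
      · rwa [Function.update_of_ne hj]
    refine ⟨m, I, r, t, Function.update q i u, him, hI, hr, hrm, hIr, Function.update_self ..,
      fun j h₁ h₂ => ?_, fun j h₁ h₂ => hq' j (hred j h₁ h₂), hq' m hend⟩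
    rw [Function.update_of_ne (by omega)]
    exact hqt j h₁ h₂

end MixedLogic

theorem theorem8p4 {L : FirstOrder.Language} (zero : L.Functions 0) (succ : L.Functions 1)
    (E : Set (L.Term ℕ × L.Term ℕ)) (hE : Adequate zero succ E)
    {P : Type*} [Infinite P]
    (n : ℕ) (θ : LamC) (hθ : IsClassicalInteger zero succ E n θ)
    (x g : ℕ) (hxg : x ≠ g) :
    (n = 0 → ∀ p : P,
      (LamCP.appStack (.app (.app (θ.toLamCP P) (.var x)) (.var g)) p).Reduces
        (.appStack (.var x) p)) ∧
    (n ≠ 0 → ∃ m : ℕ, 1 ≤ m ∧ ∃ (I : ℕ → ℕ) (r : ℕ → ℕ),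
      (∀ i ≤ m, r i ≤ m) ∧
      I 0 = n ∧ I (r m) = 0 ∧ (∀ i < m, (I (i + 1) : ℤ) = (I (r i) : ℤ) - 1) ∧
      ∀ p : ℕ → P, Set.InjOn p {i | i ≤ m} → ∃ t : ℕ → LamCP P,
        (LamCP.appStack (.app (.app (θ.toLamCP P) (.var x)) (.var g)) (p 0)).Reduces
          (.appStack (.app (.var g) (t 1)) (p (r 0))) ∧
        (∀ i, 1 ≤ i → i < m →
          (LamCP.appStack (t i) (p i)).Reduces
            (.appStack (.app (.var g) (t (i + 1))) (p (r i)))) ∧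
        (LamCP.appStack (t m) (p m)).Reduces (.appStack (.var x) (p (r m)))) := by
  obtain ⟨m, I, r, t, q, -, hI, hr, hrm, hIr, hq, hqt, hred, hend⟩ :=
    (wins_of_isClassicalInteger hE hθ x g 0).exists_run 0 (fun _ => n)
      ⟨⟨⟨LamCP.constsIn_toLamCP _ θ, trivial⟩, trivial⟩, le_rfl, rfl⟩
  have hI₀ : I 0 = n := hI 0 le_rfl
  have hr₀ : r 0 = 0 := Nat.le_zero.1 (hr 0 le_rfl (Nat.zero_le m))
  refine ⟨fun hn p => ?_, fun hn => ?_⟩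
  · -- Stage `0` knows only one constant, of value `0`, so `g` cannot come to the head.
    obtain rfl : m = 0 := by
      by_contra hm
      have := hIr 0 le_rfl (Nat.pos_of_ne_zero hm)
      rw [hr₀] at this
      omega
    have := hend.mapConst (fun _ => p)
    rw [hq] at this
    simpa only [LamCP.mapConst, LamCP.mapConst_toLamCP] using this
  · have hm : 1 ≤ m := by
      by_contra hm
      obtain rfl : m = 0 := by omega
      rw [hr₀] at hrm
      exact hn (hI₀.symm.trans hrm)
    refine ⟨m, hm, I, r, fun i hi => (hr i (Nat.zero_le i) hi).trans hi, hI₀, hrm,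
      fun i hi => ?_, fun p _ => ⟨fun i => (t i).mapConst fun c => p c.1, ?_, fun i h₁ h₂ => ?_, ?_⟩⟩
    · have := hIr i (Nat.zero_le i) hi
      omega
    · have := (hred 0 le_rfl hm).mapConst fun c => p c.1
      rw [hq] at this
      simpa only [LamCP.mapConst, LamCP.mapConst_toLamCP] using this
    · have := (hred i (Nat.zero_le i) h₂).mapConst fun c => p c.1
      rw [hqt i h₁ h₂.le] at this
      exact this
    · have := hend.mapConst fun c => p c.1
      rw [hqt m hm le_rfl] at this
      exact this
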